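/- **Language.** Let $\mathcal N_O$ (objects, containing $\mathbb Q$), $\mathcal N_A$ (actions: function symbols applied to object names) and $\mathcal N_C$ (clocks) be the countably infinite sets of standard names. Predicates are fluent predicates $F_i^k$, rigid predicates $G_i^k$ (of arity $k$, taking object or action arguments), and the distinguished fluent predicates $Poss(a)$, $g(a)$ (clock constraint of action $a$) and $reset(c)$ ($c$ a clock). A primitive formula is a predicate applied to standard names. Static formulas are built from atoms, equalities, $\top,\wedge,\neg,\forall$; they are fluent if they do not mention $Poss$. Clock formulas are built from $\top$ and $c\bowtie r$ ($c\in\mathcal N_C$, $\bowtie\,\in\{<,\le,=,\ge,>\}$, $r\in\mathbb N$) by $\wedge$ and $\square$. Program expressions are $\delta::= t\mid\alpha?\mid\delta;\delta\mid\delta|\delta\mid\delta\|\delta\mid\delta^*$ with $t$ an action term and $\alpha$ static; $nil:=\top?$. **Semantics.** A timed trace is a finite sequence of pairs in $\mathcal N_A\times\mathbb R_{\ge0}$ with non-decreasing times; $\mathrm{time}(z)$ is its last time ($0$ if $z=\langle\rangle$). A clock valuation is a map $\nu:\mathcal N_C\to\mathbb R_{\ge 0}$; $\vec 0$ is the zero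 valuation. A world $w$ assigns a truth value to every primitive formula at every $(z,\nu)$, where rigid predicates do not depend on $z$ and only $g$ may depend on $\nu$; $w,z\models f$ means truth at $(z,\vec 0)$. Static formulas are interpreted as usual, with quantifiers ranging over the standard names; free variables are implicitly universally quantified. Further, $\square\alpha$ holds at $(z,\nu)$ if $\alpha$ holds at all $(z',\nu')$ with $z$ a prefix of $z'$ and $\nu\le\nu'$, and $[a]\alpha$ holds at $(z,\nu)$ if, for all $d\ge0$, $\alpha$ holds at $(z',\nu')$ with $z'=z\cdot(a,\mathrm{time}(z)+d)$, where $\nu'(c)=0$ if $w,z'\models reset(c)$ and $\nu'(c)=\nu(c)+d$ otherwise. The program transition relation $\to_w$ on configurations $\langle z,\nu,\delta\rangle$ is the usual Golog (ConGolog) one, with tests that are not actions but are final when true and with interleaving for $\|$, based on the rule $\langle z,\nu,a\rangle\to_w\langle z',\nu',nil\rangle$ for an action name $a$, with $z',\nu'$ as above for some $d\ge0$, provided $w,z\models Poss(a)$ and $w,z,\nu+d\models g(a)$. **Theories.** A basic action theory over finite sets $\mathcal F$ of fluent predicates and $C$ of clocks is a set $\Sigma$, mentioning only fluent predicates in $\mathcal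 F$ (besides the distinguished ones) and clocks in $C$, which consists of a set $\Sigma_0$ of fluent formulas; one axiom $\square(Poss(a)\equiv\bigvee_o\pi_o)$ with finitely many fluent formulas $\pi_o$; for each action $p$ from some set an axiom $\square(g(p)\equiv g_p)$ with a clock formula $g_p$; for each $F\in\mathcal F$ an axiom $\square([a]F(\vec x)\equiv\gamma_F)$; and for each $c\in C$ an axiom $\square([a]reset(c)\equiv\gamma_c)$, with $\gamma_F,\gamma_c$ fluent, where $a$ is an action variable and $\vec x$ are distinct object variables, $\pi_o$ and $\gamma_c$ have no free variable except $a$, and $\gamma_F$ none except $a,\vec x$. It is finite-domain if, for some rigid $\tau_o,\tau_a$, every explicit quantifier occurs as $\forall x.\,\tau_o(x)\supset\phi$ ($x$ an object variable) or $\forall a.\,\tau_a(a)\supset\phi$ ($a$ an action variable), and $\Sigma_0$ contains axioms $\tau_o(x)\equiv(x=n_1\vee\dots\vee x=n_k)$ and $\tau_a(a)\equiv(a=m_1\vee\dots\vee a=m_l)$, where the $m_j$ mention only object names $n_i$. Let $\Sigma$ be a finite-domain basic action theory that mentions only finitely many predicate symbols and standard names, $w$ a world with $w\models\Sigma$ (that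 is, all formulas of $\Sigma$ hold at $(\langle\rangle,\vec 0)$), and $\delta$ a program expression. Let $\mathcal P_\Sigma$ be the set of primitive formulas that mention only symbols and standard names from $\Sigma$, $A_\Sigma$ the set of action names mentioned in $\Sigma$, and $$sub(\delta)=\{\delta'\mid \exists w'\models\Sigma,\ z,\ \nu:\ \langle\langle\rangle,\vec0,\delta\rangle\to_{w'}^*\langle z,\nu,\delta'\rangle\}.$$ Let $\mathcal S_\Delta$ be the set of symbolic traces, i.e. finite words of triples $(a,g,Y)$ with $a\in A_\Sigma$, $g$ a clock formula over $C$ and $Y\subseteq C$. For $s=(a_1,g_1,Y_1)\cdots(a_n,g_n,Y_n)\in\mathcal S_\Delta$, let $tw(s)$ be the set of timed traces $z=(a_1,t_1)\cdots(a_n,t_n)$ for which there are $\nu_0=\vec 0,\nu_1,\dots,\nu_n$ and $\rho_0=\delta$, $\rho_1,\dots,\rho_n\in sub(\delta)$ with $\langle z_{i-1},\nu_{i-1},\rho_{i-1}\rangle\to_w\langle z_i,\nu_i,\rho_i\rangle$ ($z_i$ the prefix of $z$ of length $i$) such that, with $d_i=t_i-t_{i-1}$ and $t_0=0$, $\nu_{i-1}+d_i\models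 g_i$ and, for $c\in C$, $\nu_i(c)=0$ if $c\in Y_i$ and $\nu_i(c)=\nu_{i-1}(c)+d_i$ otherwise. Put $F(z)=\{f\in\mathcal P_\Sigma\mid w,z\models f\}$ and $F(tw(s))=\{F(z)\mid z\in tw(s)\}$. Let $\phi$ be an MTL formula over $\mathcal P_\Sigma$ whose intervals have natural (or infinite) endpoints, $K$ the greatest constant in $\phi$ ($0$ if there is none), and $L$ the finite set of locations of an alternating timed automaton over the alphabet $2^{\mathcal P_\Sigma}$ (in particular, of one that recognizes $\phi$). Let $REG_K$ be the set of regions $\{i\}$ ($0\le i\le K$), $(i,i+1)$ ($0\le i<K$) and $(K,\infty)$, and let $\Lambda=2^{(C\cup L)\times REG_K}$, with $C\cup L$ a disjoint union. The states of the deterministic discrete quotient $\mathcal{DT}_\sim$ are the triples in $$SW=\mathcal S_\Delta\times sub(\delta)\times 2^{\Lambda^*}.$$ For $x=x_1\cdots x_m$ and $y=y_1\cdots y_n$ in $\Lambda^*$ write $x\preccurlyeq y$ if there is a strictly increasing $h:\{1,\dots,m\}\to\{1,\dots,n\}$ with $x_i\subseteq y_{h(i)}$ for all $i$ (monotone domination),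 and for $\mathcal C,\mathcal C'\subseteq\Lambda^*$ write $\mathcal C\sqsubseteq\mathcal C'$ if for every $x\in\mathcal C$ there is $y\in\mathcal C'$ with $x\preccurlyeq y$ (Hoare powerset order). Define $$(s,\rho,\mathcal C)\le_d(s',\rho',\mathcal C')\iff F(tw(s))=F(tw(s')),\ \ \rho=\rho',\ \ \mathcal C\sqsubseteq\mathcal C'.$$ **Theorem.** $(SW,\le_d)$ is a well-quasi-order: $\le_d$ is reflexive and transitive, and for every infinite sequence $x_0,x_1,\dots$ in $SW$ there are $i<j$ with $x_i\le_d x_j$. -/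

import Mathlib

open scoped NNReal

namespace TimedGolog

/-! ### Standard names, variables, terms -/

/-- Standard object names; the rational numbers are a subsort. -/
inductive ObjName where
  | rat (q : ℚ)
  | name (i : ℕ)

/-- Standard action names: a function symbol applied to standard object names. -/
structure ActName where
  sym : ℕ
  args : List ObjName

/-- Standard clock names. -/
structure ClkName where
  index : ℕ

/-- Variables of the three sorts. -/
inductive Var where
  | obj (i : ℕ)
  | act (i : ℕ)
  | clk (i : ℕ)
deriving DecidableEq

/-- The standard names over which a variable ranges. -/
abbrev Var.Name : Var → Type
  | .obj _ => ObjName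
  | .act _ => ActName
  | .clk _ => ClkName

/-- An assignment of standard names to variables. -/
abbrev Env := (x : Var) → x.Name

/-- Terms of one sort (with standard names `N`): variables and standard names. -/
inductive Term (N : Type) where
  | var (i : ℕ)
  | name (n : N)

def Term.evalObj (e : Env) : Term ObjName → ObjName
  | .var i => e (.obj i)
  | .name n => n

def Term.evalAct (e : Env) : Term ActName → ActName
  | .var i => e (.act i)
  | .name n => n

def Term.evalClk (e : Env) : Term ClkName → ClkName
  | .var i => e (.clk i)
  | .name n => n

/-- Object or action names. -/
inductive OAName where
  | obj (n : ObjName)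
  | act (n : ActName)

/-- Object or action terms. -/
inductive OATerm where
  | obj (t : Term ObjName)
  | act (t : Term ActName)

def OATerm.eval (e : Env) : OATerm → OAName
  | .obj t => .obj (t.evalObj e)
  | .act t => .act (t.evalAct e)

/-- Predicate symbols taking object or action arguments: the fluent predicates `F_i^k`, the rigid
predicates `G_i^k`, and the distinguished fluent predicates `Poss` and `g` (clock constraint of an
action). The distinguished fluent predicate `reset`, which takes a clock, is treated separately. -/
inductive Pred where
  | fluent (k i : ℕ)
  | rigid (k i : ℕ)
  | poss
  | guard

abbrev Pred.arity : Pred → ℕ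
  | .fluent k _ => k
  | .rigid k _ => k
  | .poss => 1
  | .guard => 1

/-- Primitive formulas: predicate symbols with standard names as arguments. -/
inductive Primitive where
  | rel (P : Pred) (ns : Fin P.arity → OAName)
  | reset (c : ClkName)

/-! ### Formulas and programs -/

/-- Static situation formulas. -/
inductive Static where
  | top
  | rel (P : Pred) (ts : Fin P.arity → OATerm)
  | reset (c : Term ClkName)
  | eq (s t : OATerm)
  | and (φ ψ : Static)
  | neg (φ : Static)
  | all (x : Var) (φ : Static)

namespace Static

def or (φ ψ : Static) : Static := .neg (.and (.neg φ) (.neg ψ))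
def imp (φ ψ : Static) : Static := .neg (.and φ (.neg ψ))
def iff (φ ψ : Static) : Static := .and (imp φ ψ) (imp ψ φ)
def disj : List Static → Static
  | [] => .neg .top
  | φ :: l => or φ (disj l)

end Static

inductive Cmp where
  | lt | le | eq | ge | gt

def Cmp.Holds : Cmp → ℝ≥0 → ℝ≥0 → Prop
  | .lt, x, y => x < y
  | .le, x, y => x ≤ y
  | .eq, x, y => x = y
  | .ge, x, y => x ≥ y
  | .gt, x, y => x > y

/-- Clock formulas (over clock names). -/
inductive ClockFormula where
  | top
  | cmp (c : ClkName) (op : Cmp) (r : ℕ)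
  | and (g h : ClockFormula)
  | always (g : ClockFormula)

/-- Program expressions: actions, tests of static situation formulas, sequence, nondeterministic
branching, interleaved concurrency, nondeterministic iteration. -/
inductive Program where
  | act (t : Term ActName)
  | test (φ : Static)
  | seq (δ₁ δ₂ : Program)
  | choice (δ₁ δ₂ : Program)
  | par (δ₁ δ₂ : Program)
  | star (δ : Program)

/-- The empty program. -/
def Program.nil : Program := .test .top

/-- The formulas in which basic action theories are written: `always α` is `□α`, and `after t α` is
`[t]α` for an action term `t`. -/
inductive Formula where
  | static (φ : Static)
  | clock (g : ClockFormula)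
  | and (α β : Formula)
  | neg (α : Formula)
  | always (α : Formula)
  | after (t : Term ActName) (α : Formula)

def Formula.imp (α β : Formula) : Formula := .neg (.and α (.neg β))
def Formula.iff (α β : Formula) : Formula := .and (imp α β) (imp β α)

/-! ### Symbols and standard names mentioned in a formula, free variables -/

/-- Predicate symbols and standard names. -/
inductive Sym where
  | pred (P : Pred)
  | reset
  | obj (n : ObjName)
  | act (n : ActName)
  | clk (n : ClkName)

def ObjName.syms (n : ObjName) : Set Sym := {Sym.obj n}

/-- An action name also mentions the object names that are its arguments. -/
def ActName.syms (p : ActName) : Set Sym := {Sym.act p} ∪ {s | ∃ n ∈ p.args, s = Sym.obj n}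

def OAName.syms : OAName → Set Sym
  | .obj n => n.syms
  | .act n => n.syms

def Term.objSyms : Term ObjName → Set Sym
  | .var _ => ∅
  | .name n => n.syms

def Term.actSyms : Term ActName → Set Sym
  | .var _ => ∅
  | .name n => n.syms

def Term.clkSyms : Term ClkName → Set Sym
  | .var _ => ∅
  | .name n => {Sym.clk n}

def OATerm.syms : OATerm → Set Sym
  | .obj t => t.objSyms
  | .act t => t.actSyms

def Primitive.syms : Primitive → Set Sym
  | .rel P ns => {Sym.pred P} ∪ ⋃ i, (ns i).syms
  | .reset c => {Sym.reset, Sym.clk c}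

def Static.syms : Static → Set Sym
  | .top => ∅
  | .rel P ts => {Sym.pred P} ∪ ⋃ i, (ts i).syms
  | .reset c => {Sym.reset} ∪ c.clkSyms
  | .eq s t => s.syms ∪ t.syms
  | .and φ ψ => φ.syms ∪ ψ.syms
  | .neg φ => φ.syms
  | .all _ φ => φ.syms

def ClockFormula.clocks : ClockFormula → Set ClkName
  | .top => ∅
  | .cmp c _ _ => {c}
  | .and g h => g.clocks ∪ h.clocks
  | .always g => g.clocks

def Formula.syms : Formula → Set Sym
  | .static φ => φ.syms
  | .clock g => Sym.clk '' g.clocks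
  | .and α β => α.syms ∪ β.syms
  | .neg α => α.syms
  | .always α => α.syms
  | .after t α => t.actSyms ∪ α.syms

def OATerm.fv : OATerm → Set Var
  | .obj (.var i) => {.obj i}
  | .act (.var i) => {.act i}
  | _ => ∅

def Static.fv : Static → Set Var
  | .top => ∅
  | .rel _ ts => ⋃ i, (ts i).fv
  | .reset (.var i) => {.clk i}
  | .reset (.name _) => ∅
  | .eq s t => s.fv ∪ t.fv
  | .and φ ψ => φ.fv ∪ ψ.fv
  | .neg φ => φ.fv
  | .all x φ => φ.fv \ {x}

/-- A fluent formula is a static formula that does not mention `Poss`. -/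
def Static.IsFluent (φ : Static) : Prop := Sym.pred .poss ∉ φ.syms

/-! ### Timed traces, worlds, truth -/

/-- Finite timed traces: action names with monotonically non-decreasing time stamps. -/
def TimedTrace := {l : List (ActName × ℝ≥0) // l.Pairwise fun x y => x.2 ≤ y.2}

namespace TimedTrace

/-- The empty trace. -/
def nil : TimedTrace := ⟨[], List.Pairwise.nil⟩

def timeOf : List (ActName × ℝ≥0) → ℝ≥0
  | [] => 0
  | [x] => x.2
  | _ :: y :: l => timeOf (y :: l)

/-- The last time stamp, and `0` for the empty trace. -/
def time (z : TimedTrace) : ℝ≥0 := timeOf z.1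

theorem le_timeOf : ∀ (l : List (ActName × ℝ≥0)), (l.Pairwise fun x y => x.2 ≤ y.2) →
    ∀ x ∈ l, x.2 ≤ timeOf l
  | [], _, x, hx => by simp at hx
  | [y], _, x, hx => by
      rw [List.mem_singleton] at hx
      rw [hx]
      exact le_refl _
  | y :: y' :: l, h, x, hx => by
      rw [List.pairwise_cons] at h
      have ih := le_timeOf (y' :: l) h.2
      rw [List.mem_cons] at hx
      rcases hx with rfl | hx
      · exact (h.1 y' (by simp)).trans (ih y' (by simp))
      · exact ih x hx

/-- `z · (p, time(z) + d)`. -/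
def snoc (z : TimedTrace) (p : ActName) (d : ℝ≥0) : TimedTrace :=
  ⟨z.1 ++ [(p, z.time + d)], by
    rw [List.pairwise_append]
    refine ⟨z.2, List.pairwise_singleton _ _, ?_⟩
    intro x hx y hy
    rw [List.mem_singleton] at hy
    subst hy
    exact (le_timeOf z.1 z.2 x hx).trans le_self_add⟩

end TimedTrace

/-- Clock valuations. -/
abbrev Valuation := ClkName → ℝ≥0

/-- A world fixes the truth of every primitive formula after every timed trace. Rigid predicates do
not depend on the trace. Only the clock-constraint predicate `g` may depend on the clock
valuation. -/
structure World where
  holds : Primitive → TimedTrace → Valuation → Prop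
  rigid : ∀ k i ns z z' ν, holds (.rel (.rigid k i) ns) z ν ↔ holds (.rel (.rigid k i) ns) z' ν
  clock_indep : ∀ P ns z ν ν', P ≠ Pred.guard → (holds (.rel P ns) z ν ↔ holds (.rel P ns) z ν')
  reset_indep : ∀ c z ν ν', holds (.reset c) z ν ↔ holds (.reset c) z ν'

/-- Truth of static formulas; quantifiers range over the standard names of the right sort. -/
def Static.Sat (w : World) (z : TimedTrace) (ν : Valuation) : Static → Env → Prop
  | .top, _ => True
  | .rel P ts, e => w.holds (.rel P fun i => (ts i).eval e) z ν
  | .reset c, e => w.holds (.reset (c.evalClk e)) z ν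
  | .eq s t, e => s.eval e = t.eval e
  | .and φ ψ, e => φ.Sat w z ν e ∧ ψ.Sat w z ν e
  | .neg φ, e => ¬ φ.Sat w z ν e
  | .all x φ, e => ∀ n : x.Name, φ.Sat w z ν (Function.update e x n)

def ClockFormula.Sat : ClockFormula → Valuation → Prop
  | .top, _ => True
  | .cmp c op r, ν => op.Holds (ν c) r
  | .and g h, ν => g.Sat ν ∧ h.Sat ν
  | .always g, ν => ∀ ν', ν ≤ ν' → g.Sat ν'

open Classical in
/-- The valuation after waiting for `d` and then reaching the trace `z'`: clocks that are reset in
`z'` are `0`, the others advance by `d`. -/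
noncomputable def World.nextVal (w : World) (ν : Valuation) (d : ℝ≥0) (z' : TimedTrace) :
    Valuation :=
  fun c => if w.holds (.reset c) z' 0 then 0 else ν c + d

/-- Truth of formulas. `[t]α`: however long one waits before doing `t`, `α` holds afterwards (whether
or not `t` is possible, as in the successor state axioms). -/
def Formula.Sat (w : World) : Formula → TimedTrace → Valuation → Env → Prop
  | .static φ, z, ν, e => φ.Sat w z ν e
  | .clock g, _, ν, _ => g.Sat ν
  | .and α β, z, ν, e => α.Sat w z ν e ∧ β.Sat w z ν e
  | .neg α, z, ν, e => ¬ α.Sat w z ν e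
  | .always α, z, ν, e => ∀ (z' : TimedTrace) (ν' : Valuation), z.1 <+: z'.1 → ν ≤ ν' →
      α.Sat w z' ν' e
  | .after t α, z, ν, e => ∀ d : ℝ≥0,
      α.Sat w (z.snoc (t.evalAct e) d) (w.nextVal ν d (z.snoc (t.evalAct e) d)) e

/-! ### Program transitions -/

/-- Configurations `⟨z, ν, δ⟩`. -/
structure Config where
  trace : TimedTrace
  val : Valuation
  prog : Program

def Poss (p : ActName) : Primitive := .rel .poss fun _ => .act p
def Guard (p : ActName) : Primitive := .rel .guard fun _ => .act p

/-- Final configurations. -/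
inductive Final (w : World) (z : TimedTrace) (ν : Valuation) : Program → Prop
  | test {φ} : (∀ e, φ.Sat w z ν e) → Final w z ν (.test φ)
  | seq {δ₁ δ₂} : Final w z ν δ₁ → Final w z ν δ₂ → Final w z ν (.seq δ₁ δ₂)
  | choice_left {δ₁ δ₂} : Final w z ν δ₁ → Final w z ν (.choice δ₁ δ₂)
  | choice_right {δ₁ δ₂} : Final w z ν δ₂ → Final w z ν (.choice δ₁ δ₂)
  | star {δ} : Final w z ν (.star δ)
  | par {δ₁ δ₂} : Final w z ν δ₁ → Final w z ν δ₂ → Final w z ν (.par δ₁ δ₂)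

/-- The program transition relation in the world `w`. -/
inductive Trans (w : World) : Config → Config → Prop
  | act {z ν p} (d : ℝ≥0) : w.holds (Poss p) z 0 → w.holds (Guard p) z (fun c => ν c + d) →
      Trans w ⟨z, ν, .act (.name p)⟩ ⟨z.snoc p d, w.nextVal ν d (z.snoc p d), .nil⟩
  | seq_left {z ν z' ν' δ₁ δ₂ γ} : Trans w ⟨z, ν, δ₁⟩ ⟨z', ν', γ⟩ →
      Trans w ⟨z, ν, .seq δ₁ δ₂⟩ ⟨z', ν', .seq γ δ₂⟩
  | seq_right {z ν z' ν' δ₁ δ₂ γ} : Final w z ν δ₁ → Trans w ⟨z, ν, δ₂⟩ ⟨z', ν', γ⟩ →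
      Trans w ⟨z, ν, .seq δ₁ δ₂⟩ ⟨z', ν', γ⟩
  | choice_left {z ν z' ν' δ₁ δ₂ γ} : Trans w ⟨z, ν, δ₁⟩ ⟨z', ν', γ⟩ →
      Trans w ⟨z, ν, .choice δ₁ δ₂⟩ ⟨z', ν', γ⟩
  | choice_right {z ν z' ν' δ₁ δ₂ γ} : Trans w ⟨z, ν, δ₂⟩ ⟨z', ν', γ⟩ →
      Trans w ⟨z, ν, .choice δ₁ δ₂⟩ ⟨z', ν', γ⟩
  | star {z ν z' ν' δ γ} : Trans w ⟨z, ν, δ⟩ ⟨z', ν', γ⟩ →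
      Trans w ⟨z, ν, .star δ⟩ ⟨z', ν', .seq γ (.star δ)⟩
  | par_left {z ν z' ν' δ₁ δ₂ γ} : Trans w ⟨z, ν, δ₁⟩ ⟨z', ν', γ⟩ →
      Trans w ⟨z, ν, .par δ₁ δ₂⟩ ⟨z', ν', .par γ δ₂⟩
  | par_right {z ν z' ν' δ₁ δ₂ γ} : Trans w ⟨z, ν, δ₂⟩ ⟨z', ν', γ⟩ →
      Trans w ⟨z, ν, .par δ₁ δ₂⟩ ⟨z', ν', .par δ₁ γ⟩

/-! ### Basic action theories -/

/-- The constituents of a basic action theory: a finite set of fluent predicates `F_i^k`, given as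
pairs `(k, i)`, and a finite set of clocks; the initial sentences; one precondition formula for each
(of finitely many) action type; the clock constraint of each action; for each fluent predicate and
each clock the right-hand side of its successor state axiom. The action variable `a` of the axioms is
`Var.act 0`, the object variables `x_1, …, x_k` are `Var.obj 0, …, Var.obj (k - 1)`. Values of
`guard`, `post`, `resetPost` outside `acts`, `fluents`, `clocks` are not used. -/
structure ActionTheory where
  fluents : Set (ℕ × ℕ)
  clocks : Set ClkName
  init : Set Static
  pre : List Static
  acts : Set ActName
  guard : ActName → ClockFormula
  post : ℕ × ℕ → Static
  resetPost : ClkName → Static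

/-- The action variable `a`. -/
def actVar : Term ActName := .var 0

namespace ActionTheory

/-- `□ Poss(a) ≡ ⋁ π_o`. -/
def preAxiom (𝒟 : ActionTheory) : Formula :=
  .always (.iff (.static (.rel .poss fun _ => .act actVar)) (.static (.disj 𝒟.pre)))

/-- `□ g(p) ≡ g_p`. -/
def guardAxiom (𝒟 : ActionTheory) (p : ActName) : Formula :=
  .always (.iff (.static (.rel .guard fun _ => .act (.name p))) (.clock (𝒟.guard p)))

/-- `□ [a]F(x_1, …, x_k) ≡ γ_F`. -/
def postAxiom (𝒟 : ActionTheory) (F : ℕ × ℕ) : Formula :=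
  .always (.iff
    (.after actVar (.static (.rel (.fluent F.1 F.2) fun i => .obj (.var i.1))))
    (.static (𝒟.post F)))

/-- `□ [a]reset(c) ≡ γ_c`. -/
def resetAxiom (𝒟 : ActionTheory) (c : ClkName) : Formula :=
  .always (.iff (.after actVar (.static (.reset (.name c)))) (.static (𝒟.resetPost c)))

/-- The set `Σ` of all sentences of the theory. -/
def sentences (𝒟 : ActionTheory) : Set Formula :=
  Formula.static '' 𝒟.init ∪ {𝒟.preAxiom} ∪ 𝒟.guardAxiom '' 𝒟.acts ∪
    𝒟.postAxiom '' 𝒟.fluents ∪ 𝒟.resetAxiom '' 𝒟.clocks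

/-- The predicate symbols and standard names that `Σ` mentions. -/
def syms (𝒟 : ActionTheory) : Set Sym := ⋃ α ∈ 𝒟.sentences, α.syms

/-- `Σ` is a basic action theory over its fluent predicates and clocks. -/
structure IsBAT (𝒟 : ActionTheory) : Prop where
  finite_fluents : 𝒟.fluents.Finite
  finite_clocks : 𝒟.clocks.Finite
  mentions_fluents : ∀ k i, Sym.pred (.fluent k i) ∈ 𝒟.syms → (k, i) ∈ 𝒟.fluents
  mentions_clocks : ∀ c, Sym.clk c ∈ 𝒟.syms → c ∈ 𝒟.clocks
  init_fluent : ∀ φ ∈ 𝒟.init, φ.IsFluent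
  pre_fluent : ∀ φ ∈ 𝒟.pre, φ.IsFluent ∧ φ.fv ⊆ {Var.act 0}
  post_fluent : ∀ F ∈ 𝒟.fluents, (𝒟.post F).IsFluent ∧
    (𝒟.post F).fv ⊆ {Var.act 0} ∪ {x | ∃ j < F.1, x = Var.obj j}
  reset_fluent : ∀ c ∈ 𝒟.clocks, (𝒟.resetPost c).IsFluent ∧ (𝒟.resetPost c).fv ⊆ {Var.act 0}

end ActionTheory

/-- The formula `τ(t)` for the `i`-th unary rigid predicate `τ`. -/
def rigidAtom (i : ℕ) (t : OATerm) : Static := .rel (.rigid 1 i) fun _ => t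

/-- Every quantifier in the formula occurs as `∀ x. τ_o(x) ⊃ φ` with `x` of sort object, or as
`∀ x. τ_a(x) ⊃ φ` with `x` of sort action. -/
inductive Static.Guarded (τo τa : ℕ) : Static → Prop
  | top : Guarded τo τa .top
  | rel (P ts) : Guarded τo τa (.rel P ts)
  | reset (c) : Guarded τo τa (.reset c)
  | eq (s t) : Guarded τo τa (.eq s t)
  | and {φ ψ} : Guarded τo τa φ → Guarded τo τa ψ → Guarded τo τa (.and φ ψ)
  | neg {φ} : Guarded τo τa φ → Guarded τo τa (.neg φ)
  | allObj (i) {φ} : Guarded τo τa φ →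
      Guarded τo τa (.all (.obj i) (.imp (rigidAtom τo (.obj (.var i))) φ))
  | allAct (i) {φ} : Guarded τo τa φ →
      Guarded τo τa (.all (.act i) (.imp (rigidAtom τa (.act (.var i))) φ))

/-- Finite-domain basic action theories: all (explicit) quantifiers are guarded by `τ_o`, `τ_a`, and
the initial sentences contain `τ_o(x) ≡ (x = n_1 ∨ … ∨ x = n_k)` and
`τ_a(a) ≡ (a = m_1 ∨ … ∨ a = m_l)`, where the `m_j` mention only object names `n_i`. -/
def ActionTheory.IsFiniteDomain (𝒟 : ActionTheory) : Prop :=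
  ∃ τo τa : ℕ,
    (∀ φ ∈ 𝒟.init, φ.Guarded τo τa) ∧
    (∀ φ ∈ 𝒟.pre, φ.Guarded τo τa) ∧
    (∀ F ∈ 𝒟.fluents, (𝒟.post F).Guarded τo τa) ∧
    (∀ c ∈ 𝒟.clocks, (𝒟.resetPost c).Guarded τo τa) ∧
    ∃ (ns : List ObjName) (ms : List ActName) (i j : ℕ),
      Static.iff (rigidAtom τo (.obj (.var i)))
        (.disj (ns.map fun n => .eq (.obj (.var i)) (.obj (.name n)))) ∈ 𝒟.init ∧
      Static.iff (rigidAtom τa (.act (.var j)))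
        (.disj (ms.map fun m => .eq (.act (.var j)) (.act (.name m)))) ∈ 𝒟.init ∧
      ∀ m ∈ ms, ∀ n ∈ m.args, n ∈ ns

/-- `w ⊨ Σ`; free variables are implicitly universally quantified. -/
def World.Models (w : World) (𝒟 : ActionTheory) : Prop :=
  ∀ α ∈ 𝒟.sentences, ∀ e : Env, α.Sat w .nil 0 e

namespace ActionTheory

/-- The primitive formulas `P_Σ` that mention only symbols and standard names from `Σ`. -/
def primes (𝒟 : ActionTheory) : Set Primitive := {f | f.syms ⊆ 𝒟.syms}

/-- The action standard names `A_Σ` mentioned in `Σ`. -/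
def actions (𝒟 : ActionTheory) : Set ActName := {p | Sym.act p ∈ 𝒟.syms}

/-- The reachable subprograms `sub(δ)` of the program `(Σ, δ)`. -/
def sub (𝒟 : ActionTheory) (δ : Program) : Set Program :=
  {δ' | ∃ w : World, w.Models 𝒟 ∧ ∃ z ν,
    Relation.ReflTransGen (Trans w) ⟨.nil, 0, δ⟩ ⟨z, ν, δ'⟩}

/-- Letters `(a, g, Y)` of the symbolic alphabet: an action of `Σ`, a clock formula over the clocks
of `Σ` (its guard), and a set of clocks of `Σ` (the clocks that are reset). -/
structure SymLetter (𝒟 : ActionTheory) where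
  act : 𝒟.actions
  guard : {g : ClockFormula // g.clocks ⊆ 𝒟.clocks}
  resets : Set 𝒟.clocks

/-- Symbolic traces. -/
abbrev SymTrace (𝒟 : ActionTheory) := List 𝒟.SymLetter

/-- `SymRun 𝒟 w δ s z ν ρ`: in the world `w`, the program `δ` can take transitions from
`⟨⟨⟩, 0, δ⟩` to `⟨z, ν, ρ⟩` that carry out the actions of `s`, through programs in `sub(δ)` and
through valuations that satisfy the guards and perform the resets of `s`. -/
inductive SymRun (𝒟 : ActionTheory) (w : World) (δ : Program) :
    𝒟.SymTrace → TimedTrace → Valuation → Program → Prop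
  | nil : SymRun 𝒟 w δ [] .nil 0 δ
  | snoc {s z ν ρ ν' ρ'} (l : 𝒟.SymLetter) (d : ℝ≥0) :
      SymRun 𝒟 w δ s z ν ρ →
      Trans w ⟨z, ν, ρ⟩ ⟨z.snoc l.act d, ν', ρ'⟩ →
      ρ' ∈ 𝒟.sub δ →
      l.guard.1.Sat (fun c => ν c + d) →
      (∀ c : 𝒟.clocks, (c ∈ l.resets → ν' c = 0) ∧ (c ∉ l.resets → ν' c = ν c + d)) →
      SymRun 𝒟 w δ (s ++ [l]) (z.snoc l.act d) ν' ρ'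

/-- The set `tw(s)` of timed traces induced by a symbolic trace. -/
def tw (𝒟 : ActionTheory) (w : World) (δ : Program) (s : 𝒟.SymTrace) : Set TimedTrace :=
  {z | ∃ ν ρ, 𝒟.SymRun w δ s z ν ρ}

/-- The set `F(z)` of primitive formulas of `Σ` that hold after `z`. -/
def fluentsAt (𝒟 : ActionTheory) (w : World) (z : TimedTrace) : Set 𝒟.primes :=
  {f | w.holds f.1 z 0}

end ActionTheory

/-! ### Metric temporal logic and alternating timed automata -/

/-- An interval of non-negative reals with natural endpoints: `(n, true)` is the closed endpoint `n`,
`(n, false)` the open one; no upper endpoint means that the interval is unbounded. -/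
structure Interval where
  lower : ℕ × Bool
  upper : Option (ℕ × Bool)

/-- The greatest constant of an interval. -/
def Interval.maxConst (I : Interval) : ℕ :=
  match I.upper with
  | none => I.lower.1
  | some u => max I.lower.1 u.1

/-- MTL formulas over the atomic propositions `P`. -/
inductive MTL (P : Type) where
  | atom (p : P)
  | neg (φ : MTL P)
  | and (φ ψ : MTL P)
  | untl (I : Interval) (φ ψ : MTL P)

/-- The greatest constant mentioned in an MTL formula (`0` if there is none). -/
def MTL.maxConst {P : Type} : MTL P → ℕ
  | .atom _ => 0
  | .neg φ => φ.maxConst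
  | .and φ ψ => max φ.maxConst ψ.maxConst
  | .untl I φ ψ => max I.maxConst (max φ.maxConst ψ.maxConst)

/-- The formulas `Φ(L)` over a set `L` of locations; `reset φ` is `x.φ`. -/
inductive LocFormula (L : Type) where
  | top
  | bot
  | and (φ ψ : LocFormula L)
  | or (φ ψ : LocFormula L)
  | loc (l : L)
  | cmp (op : Cmp) (k : ℕ)
  | reset (φ : LocFormula L)

/-- Alternating timed automata over the alphabet `A`. -/
structure ATA (A : Type) where
  Loc : Type
  finite_loc : Finite Loc
  start : Loc
  accepting : Set Loc
  trans : Loc → A → LocFormula Loc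

/-! ### Regions, and the states of the deterministic discrete quotient -/

/-- The regions `r_{2i} = {i}` and `r_{2i+1} = (i, i+1)`, where the last one is
`r_{2K+1} = (K, ∞)`. -/
def region (K j : ℕ) : Set ℝ≥0 :=
  if j = 2 * K + 1 then Set.Ioi (K : ℝ≥0)
  else if j % 2 = 0 then {((j / 2 : ℕ) : ℝ≥0)}
  else Set.Ioo ((j / 2 : ℕ) : ℝ≥0) ((j / 2 : ℕ) + 1)

/-- The set `REG_K = {r_0, …, r_{2K+1}}`. -/
def REG (K : ℕ) : Set (Set ℝ≥0) := {r | ∃ j ≤ 2 * K + 1, r = region K j}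

/-- The monotone domination order on finite words that is induced by `r`. -/
def MonotoneDomination {S : Type} (r : S → S → Prop) (x y : List S) : Prop :=
  ∃ h : Fin x.length → Fin y.length, StrictMono h ∧ ∀ i, r (x.get i) (y.get (h i))

/-- The (Hoare) powerset order that is induced by `r`. -/
def PowersetOrder {S : Type} (r : S → S → Prop) (A B : Set S) : Prop :=
  ∀ a ∈ A, ∃ b ∈ B, r a b

section States

variable (𝒟 : ActionTheory) (δ : Program) (φ : MTL 𝒟.primes) (𝒜 : ATA (Set 𝒟.primes))

/-- The alphabet `Λ = 2^{(C ∪ L) × REG_K}`, where `K` is the greatest constant in `φ`. -/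
abbrev RegLetter := Set ((𝒟.clocks ⊕ 𝒜.Loc) × REG φ.maxConst)

/-- The states `(s, ρ, 𝒞)` of the deterministic discrete quotient: the product of the set of symbolic
traces, of `sub(δ)`, and of the powerset of `Λ^*`. -/
structure DTState where
  trace : 𝒟.SymTrace
  prog : 𝒟.sub δ
  configs : Set (List (RegLetter 𝒟 φ 𝒜))

end States

/-- The order `≤_d` on states: `F(tw(s)) = F(tw(s'))`, `ρ = ρ'`, and `𝒞 ⊑ 𝒞'`. -/
def DTState.Le {𝒟 : ActionTheory} {δ : Program} {φ : MTL 𝒟.primes} {𝒜 : ATA (Set 𝒟.primes)}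
    (w : World) (x y : DTState 𝒟 δ φ 𝒜) : Prop :=
  𝒟.fluentsAt w '' 𝒟.tw w δ x.trace = 𝒟.fluentsAt w '' 𝒟.tw w δ y.trace ∧
  x.prog = y.prog ∧
  PowersetOrder (MonotoneDomination fun l l' : RegLetter 𝒟 φ 𝒜 => l ⊆ l') x.configs y.configs

end TimedGolog

/-! ### Higman's lemma and languages closed under subwords -/

section Subwords

variable {α : Type*}

/-! Only the third component of a state is difficult. The symbolic trace enters the order through a
set of subsets of the finite set `𝒟.primes`, so it takes finitely many values, and `𝒟.sub δ` is
finite because every reachable program lies in the finite set `Program.residuals δ`.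

For sets of words Higman's lemma is not enough: the Hoare powerset order over an arbitrary
well-quasi-order need not be a well-quasi-order (Rado). What saves the theorem is that the alphabet
is finite. Comparing two sets of words reduces to inclusion of their closures under subwords. Such a
closure is the complement of the superwords of finitely many words, and hence a finite union of
products of atoms `a?` and `A*` (`exists_sumLang_eq`). So it is denoted by a finite list of lists
over a finite set of atoms. Applying Higman's lemma twice well-quasi-orders these expressions, and
if one expression embeds in another, its language is included in the other's (`sumLang_mono`). -/

theorem wellQuasiOrdered_sublistForall₂ {r : α → α → Prop} [IsPreorder α r]
    (h : WellQuasiOrdered r) : WellQuasiOrdered (List.SublistForall₂ r) := by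
  have h' := Set.PartiallyWellOrderedOn.partiallyWellOrderedOn_sublistForall₂ r
    (Set.partiallyWellOrderedOn_univ_iff.2 h)
  intro f
  exact Set.PartiallyWellOrderedOn.exists_lt h' (f := f) fun n x _ => Set.mem_univ x

/-- This allows Higman's lemma to be iterated, from atoms to products and from products to unions.
-/
instance sublistForall₂_isPreorder (r : α → α → Prop) [IsPreorder α r] :
    IsPreorder (List α) (List.SublistForall₂ r) where

theorem sublist_of_sublistForall₂_eq {x y : List α} (h : List.SublistForall₂ (· = ·) x y) :
    x.Sublist y := by
  obtain ⟨l, hl, hly⟩ := List.sublistForall₂_iff.1 h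
  rw [List.forall₂_eq_eq_eq] at hl
  exact hl ▸ hly

theorem wellQuasiOrdered_sublist [Finite α] : WellQuasiOrdered (List.Sublist (α := α)) := by
  intro f
  obtain ⟨m, n, hmn, h⟩ :=
    wellQuasiOrdered_sublistForall₂ (Finite.wellQuasiOrdered (α := α) (· = ·)) f
  exact ⟨m, n, hmn, sublist_of_sublistForall₂_eq h⟩

/-! ### Products of atoms and their finite unions -/

/-- The language of a product of atoms: `.inl a` stands for `a?`, and `.inr A` for `A*`. -/
def productLang : List (α ⊕ Set α) → Set (List α)
  | [] => {[]}
  | .inl a :: P => {x | x ∈ productLang P ∨ ∃ y ∈ productLang P, x = a :: y}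
  | .inr A :: P => {x | ∃ u v, (∀ a ∈ u, a ∈ A) ∧ v ∈ productLang P ∧ x = u ++ v}

/-- The language of a finite union of products of atoms. -/
def sumLang (Ps : List (List (α ⊕ Set α))) : Set (List α) := {x | ∃ P ∈ Ps, x ∈ productLang P}

theorem mem_sumLang_append {Ps Qs : List (List (α ⊕ Set α))} {x : List α} :
    x ∈ sumLang (Ps ++ Qs) ↔ x ∈ sumLang Ps ∨ x ∈ sumLang Qs := by
  simp [sumLang, or_and_right, exists_or]

/-- Prefixing an atom distributes over unions, so an atom can be put in front of a whole union
supplied by an induction hypothesis. -/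
theorem mem_sumLang_map_inl {Ps : List (List (α ⊕ Set α))} {a : α} {x : List α} :
    x ∈ sumLang (Ps.map (.inl a :: ·)) ↔ x ∈ sumLang Ps ∨ ∃ y ∈ sumLang Ps, x = a :: y := by
  simp only [sumLang, List.mem_map, Set.mem_ofPred_eq]
  constructor
  · rintro ⟨_, ⟨P, hP, rfl⟩, h | ⟨y, hy, rfl⟩⟩
    · exact .inl ⟨P, hP, h⟩
    · exact .inr ⟨y, ⟨P, hP, hy⟩, rfl⟩
  · rintro (⟨P, hP, h⟩ | ⟨y, ⟨P, hP, hy⟩, rfl⟩)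
    · exact ⟨_, ⟨P, hP, rfl⟩, .inl h⟩
    · exact ⟨_, ⟨P, hP, rfl⟩, .inr ⟨y, hy, rfl⟩⟩

theorem mem_sumLang_map_inr {Ps : List (List (α ⊕ Set α))} {A : Set α} {x : List α} :
    x ∈ sumLang (Ps.map (.inr A :: ·)) ↔
      ∃ u v, (∀ a ∈ u, a ∈ A) ∧ v ∈ sumLang Ps ∧ x = u ++ v := by
  simp only [sumLang, List.mem_map, Set.mem_ofPred_eq]
  constructor
  · rintro ⟨_, ⟨P, hP, rfl⟩, u, v, hu, hv, rfl⟩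
    exact ⟨u, v, hu, ⟨P, hP, hv⟩, rfl⟩
  · rintro ⟨u, v, hu, ⟨P, hP, hv⟩, rfl⟩
    exact ⟨_, ⟨P, hP, rfl⟩, u, v, hu, hv, rfl⟩

theorem productLang_subset_cons (t : α ⊕ Set α) (P : List (α ⊕ Set α)) :
    productLang P ⊆ productLang (t :: P) := by
  intro x hx
  cases t with
  | inl a => exact .inl hx
  | inr A => exact ⟨[], x, by simp, hx, rfl⟩

theorem nil_mem_productLang (P : List (α ⊕ Set α)) : [] ∈ productLang P := by
  induction P with
  | nil => rfl
  | cons t P ih => exact productLang_subset_cons t P ih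

/-- Every atom admits the empty word, so inserting further atoms can only enlarge the language. -/
theorem productLang_mono {P Q : List (α ⊕ Set α)} (h : List.SublistForall₂ (· = ·) P Q) :
    productLang P ⊆ productLang Q := by
  induction h with
  | nil =>
    intro x hx
    rw [Set.mem_singleton_iff.1 hx]
    exact nil_mem_productLang _
  | @cons t t' P Q htt _ ih =>
    subst htt
    cases t with
    | inl a =>
      rintro x (hx | ⟨y, hy, rfl⟩)
      · exact .inl (ih hx)
      · exact .inr ⟨y, ih hy, rfl⟩
    | inr A =>
      rintro x ⟨u, v, hu, hv, rfl⟩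
      exact ⟨u, v, hu, ih hv, rfl⟩
  | cons_right _ ih => exact ih.trans (productLang_subset_cons _ _)

theorem sumLang_mono {Ps Qs : List (List (α ⊕ Set α))}
    (h : List.SublistForall₂ (List.SublistForall₂ (· = ·)) Ps Qs) : sumLang Ps ⊆ sumLang Qs := by
  induction h with
  | nil => rintro x ⟨P, hP, -⟩; cases hP
  | cons hPQ _ ih =>
    rintro x ⟨P, hP, hx⟩
    rcases List.mem_cons.1 hP with rfl | hP
    · exact ⟨_, List.mem_cons_self, productLang_mono hPQ hx⟩
    · obtain ⟨Q, hQ, hx⟩ := ih ⟨P, hP, hx⟩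
      exact ⟨Q, List.mem_cons_of_mem _ hQ, hx⟩
  | cons_right _ ih =>
    intro x hx
    obtain ⟨Q, hQ, hx⟩ := ih hx
    exact ⟨Q, List.mem_cons_of_mem _ hQ, hx⟩

/-! ### Words that avoid a given subword -/

/-- The leading `b` finds no match in `u`, so the whole embedding takes place in `y`. -/
theorem cons_sublist_append_iff {b : α} {u w y : List α} (hb : b ∉ u) :
    (b :: w).Sublist (u ++ y) ↔ (b :: w).Sublist y := by
  induction u with
  | nil => rfl
  | cons c u ih =>
    rw [List.mem_cons, not_or] at hb
    rw [List.cons_append, List.sublist_cons_iff, ih hb.2]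
    constructor
    · rintro (h | ⟨r, hr, -⟩)
      · exact h
      · exact absurd (List.cons.inj hr).1 hb.1
    · exact .inl

/-- Removing the superwords of a word from a product of atoms leaves a finite union of products. -/
theorem exists_sumLang_eq_productLang_diff (w : List α) (P : List (α ⊕ Set α)) :
    ∃ Qs, ∀ x, x ∈ sumLang Qs ↔ x ∈ productLang P ∧ ¬ w.Sublist x := by
  -- The forbidden word is the outer induction and the product the inner one: in the case `A*` with
  -- `b ∈ A`, the word gets shorter while the product stays the same.
  induction w generalizing P with
  | nil => exact ⟨[], fun x => by simp [sumLang]⟩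
  | cons b w ihw =>
    induction P with
    | nil =>
      refine ⟨[[]], fun x => ?_⟩
      simp only [sumLang, productLang, List.mem_singleton, exists_eq_left, Set.mem_ofPred_eq,
        Set.mem_singleton_iff, iff_self_and]
      rintro rfl
      simp
    | cons t P ihP =>
      obtain ⟨Rs, hRs⟩ := ihP
      cases t with
      | inl a =>
        by_cases hab : a = b
        · subst hab
          obtain ⟨Qs, hQs⟩ := ihw P
          -- If the optional `a` is absent, the rest must avoid `a :: w`. If it is present, it can
          -- serve as the first letter of the forbidden word, and the rest must avoid `w`.
          refine ⟨Rs ++ Qs.map (.inl a :: ·), fun x => ?_⟩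
          rw [mem_sumLang_append, mem_sumLang_map_inl, hRs, hQs]
          constructor
          · rintro (⟨h, hw⟩ | ⟨h, hw⟩ | ⟨y, hy, rfl⟩)
            · exact ⟨.inl h, hw⟩
            · exact ⟨.inl h, fun h' => hw (List.sublist_of_cons_sublist h')⟩
            · obtain ⟨h, hw⟩ := (hQs y).1 hy
              exact ⟨.inr ⟨y, h, rfl⟩, fun h' => hw (List.cons_sublist_cons.1 h')⟩
          · rintro ⟨h | ⟨y, h, rfl⟩, hw⟩
            · exact .inl ⟨h, hw⟩
            · exact .inr (.inr ⟨y, (hQs y).2 ⟨h, fun h' => hw (List.cons_sublist_cons.2 h')⟩, rfl⟩)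
        · have key : ∀ y : List α, (b :: w).Sublist (a :: y) ↔ (b :: w).Sublist y := fun y =>
            cons_sublist_append_iff (u := [a]) (by simpa using Ne.symm hab)
          refine ⟨Rs.map (.inl a :: ·), fun x => ?_⟩
          rw [mem_sumLang_map_inl, hRs]
          constructor
          · rintro (⟨h, hw⟩ | ⟨y, hy, rfl⟩)
            · exact ⟨.inl h, hw⟩
            · obtain ⟨h, hw⟩ := (hRs y).1 hy
              exact ⟨.inr ⟨y, h, rfl⟩, mt (key y).1 hw⟩
          · rintro ⟨h | ⟨y, h, rfl⟩, hw⟩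
            · exact .inl ⟨h, hw⟩
            · exact .inr ⟨y, (hRs y).2 ⟨h, mt (key y).2 hw⟩, rfl⟩
      | inr A =>
        by_cases hbA : b ∈ A
        · obtain ⟨Qs, hQs⟩ := ihw (.inr A :: P)
          have hdiff : ∀ u : List α, (∀ a ∈ u, a ∈ A \ {b}) ↔ (∀ a ∈ u, a ∈ A) ∧ b ∉ u := by
            intro u
            constructor
            · exact fun h => ⟨fun a ha => (h a ha).1, fun hb => (h b hb).2 rfl⟩
            · rintro ⟨h, hb⟩ a ha
              exact ⟨h a ha, fun hab => hb (Set.mem_singleton_iff.1 hab ▸ ha)⟩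
          -- Split at the first `b` in the part contributed by `A*`. Without such a `b`, the tail in
          -- `P` must avoid `b :: w`; otherwise what follows this `b` lies in `A* P` and must avoid
          -- `w`.
          refine ⟨Rs.map (.inr (A \ {b}) :: ·) ++
            (Qs.map (.inl b :: ·)).map (.inr (A \ {b}) :: ·), fun x => ?_⟩
          rw [mem_sumLang_append, mem_sumLang_map_inr, mem_sumLang_map_inr]
          simp only [mem_sumLang_map_inl, hdiff]
          constructor
          · rintro (⟨u, v, ⟨hu, hbu⟩, hv, rfl⟩ | ⟨u, v, ⟨hu, hbu⟩, hv | ⟨y, hy, rfl⟩, rfl⟩)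
            · obtain ⟨h, hw⟩ := (hRs v).1 hv
              exact ⟨⟨u, v, hu, h, rfl⟩, mt (cons_sublist_append_iff hbu).1 hw⟩
            -- The atom `b?` may also be skipped. This adds nothing wrong, since a tail that avoids
            -- `w` also avoids `b :: w`.
            · obtain ⟨⟨u', v', hu', hv', rfl⟩, hw⟩ := (hQs v).1 hv
              refine ⟨⟨u ++ u', v', ?_, hv', by simp⟩, fun h' => hw ?_⟩
              · intro a ha
                exact (List.mem_append.1 ha).elim (hu a) (hu' a)
              · exact List.sublist_of_cons_sublist ((cons_sublist_append_iff hbu).1 h')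
            · obtain ⟨⟨u', v', hu', hv', rfl⟩, hw⟩ := (hQs y).1 hy
              refine ⟨⟨u ++ b :: u', v', ?_, hv', by simp⟩, fun h' => hw ?_⟩
              · intro a ha
                rcases List.mem_append.1 ha with ha | ha
                · exact hu a ha
                · rcases List.mem_cons.1 ha with rfl | ha
                  · exact hbA
                  · exact hu' a ha
              · exact List.cons_sublist_cons.1 ((cons_sublist_append_iff hbu).1 h')
          · rintro ⟨⟨u, v, hu, hv, rfl⟩, hw⟩
            by_cases hbu : b ∈ u
            -- This is the first occurrence of `b`: `hb₁` says that `u₁` contains none.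
            · obtain ⟨u₁, u₂, rfl, hb₁⟩ := List.eq_append_cons_of_mem hbu
              refine .inr ⟨u₁, b :: (u₂ ++ v), ⟨fun a ha => hu a (by simp [ha]), hb₁⟩,
                .inr ⟨u₂ ++ v, (hQs _).2 ⟨⟨u₂, v, fun a ha => hu a (by simp [ha]), hv, rfl⟩, ?_⟩,
                  rfl⟩, by simp⟩
              intro h'
              apply hw
              rw [List.append_assoc, cons_sublist_append_iff hb₁]
              exact List.cons_sublist_cons.2 h'
            · exact .inl ⟨u, v, ⟨hu, hbu⟩,
                (hRs v).2 ⟨hv, mt (cons_sublist_append_iff hbu).2 hw⟩, rfl⟩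
        · have key : ∀ u v : List α, (∀ a ∈ u, a ∈ A) →
              ((b :: w).Sublist (u ++ v) ↔ (b :: w).Sublist v) := fun u v hu =>
            cons_sublist_append_iff fun hb => hbA (hu b hb)
          refine ⟨Rs.map (.inr A :: ·), fun x => ?_⟩
          rw [mem_sumLang_map_inr]
          constructor
          · rintro ⟨u, v, hu, hv, rfl⟩
            obtain ⟨h, hw⟩ := (hRs v).1 hv
            exact ⟨⟨u, v, hu, h, rfl⟩, mt (key u v hu).1 hw⟩
          · rintro ⟨⟨u, v, hu, h, rfl⟩, hw⟩
            exact ⟨u, v, hu, (hRs v).2 ⟨h, mt (key u v hu).2 hw⟩, rfl⟩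

theorem exists_sumLang_eq_sumLang_diff (w : List α) (Ps : List (List (α ⊕ Set α))) :
    ∃ Qs, ∀ x, x ∈ sumLang Qs ↔ x ∈ sumLang Ps ∧ ¬ w.Sublist x := by
  induction Ps with
  | nil => exact ⟨[], fun x => by simp [sumLang]⟩
  | cons P Ps ih =>
    obtain ⟨Qs, hQs⟩ := ih
    obtain ⟨Rs, hRs⟩ := exists_sumLang_eq_productLang_diff w P
    refine ⟨Rs ++ Qs, fun x => ?_⟩
    rw [mem_sumLang_append, hQs, hRs]
    simp only [sumLang, List.mem_cons, exists_eq_or_imp, Set.mem_ofPred_eq]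
    tauto

/-! ### Languages closed under subwords -/

/-- A set of words over a finite alphabet has a finite subset of which all its words are
superwords. -/
theorem exists_finite_sublist_basis [Finite α] (U : Set (List α)) :
    ∃ B ⊆ U, B.Finite ∧ ∀ x ∈ U, ∃ b ∈ B, b.Sublist x := by
  -- The minimal words form an antichain, which is finite by Higman's lemma. Each word lies above a
  -- minimal one because proper subwords are shorter.
  refine ⟨{x ∈ U | ∀ y ∈ U, y.Sublist x → y = x}, Set.sep_subset _ _, ?_, ?_⟩
  · refine IsAntichain.finite_of_wellQuasiOrdered (r := List.Sublist) ?_ wellQuasiOrdered_sublist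
    exact fun x hx y hy hxy h => hxy (hy.2 x hx.1 h)
  · intro x
    induction hn : x.length using Nat.strong_induction_on generalizing x with
    | _ n ih =>
      intro hx
      by_cases hmin : ∀ y ∈ U, y.Sublist x → y = x
      · exact ⟨x, ⟨hx, hmin⟩, List.Sublist.refl x⟩
      · push Not at hmin
        obtain ⟨y, hy, hyx, hne⟩ := hmin
        have hlt : y.length < n := by
          rw [← hn]
          exact lt_of_le_of_ne hyx.length_le fun h => hne (hyx.eq_of_length h)
        obtain ⟨b, hb, hby⟩ := ih _ hlt y rfl hy
        exact ⟨b, hb, hby.trans hyx⟩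

/-- Every language over a finite alphabet that is closed under subwords is a finite union of
products of atoms. -/
theorem exists_sumLang_eq [Finite α] {D : Set (List α)}
    (hD : ∀ x y : List α, x.Sublist y → y ∈ D → x ∈ D) : ∃ Ps, D = sumLang Ps := by
  obtain ⟨B, hBD, hB, hbasis⟩ := exists_finite_sublist_basis Dᶜ
  have main : ∃ Ps : List (List (α ⊕ Set α)), ∀ x, x ∈ sumLang Ps ↔ ∀ b ∈ B, ¬ b.Sublist x := by
    clear hBD hbasis
    induction B, hB using Set.Finite.induction_on with
    | empty =>
      -- With no word forbidden, the single atom `univ*` gives all words; each basis word of the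
      -- complement is then removed in turn.
      refine ⟨[[.inr Set.univ]], fun x => ?_⟩
      simp only [sumLang, List.mem_singleton, exists_eq_left, Set.mem_ofPred_eq,
        Set.mem_empty_iff_false, false_imp_iff, implies_true, iff_true]
      exact ⟨x, [], by simp, rfl, by simp⟩
    | @insert b B _ _ ih =>
      obtain ⟨Ps, hPs⟩ := ih
      obtain ⟨Qs, hQs⟩ := exists_sumLang_eq_sumLang_diff b Ps
      refine ⟨Qs, fun x => ?_⟩
      rw [hQs, hPs, Set.forall_mem_insert, and_comm]
  obtain ⟨Ps, hPs⟩ := main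
  refine ⟨Ps, Set.ext fun x => ?_⟩
  rw [hPs]
  constructor
  · exact fun hx b hb hbx => hBD hb (hD b x hbx hx)
  · intro h
    by_contra hx
    obtain ⟨b, hb, hbx⟩ := hbasis x hx
    exact h b hb hbx

end Subwords

namespace TimedGolog

/-! ### The powerset order over monotone domination -/

theorem monotoneDomination_of_sublist {S : Type} {r : S → S → Prop} (hr : ∀ a, r a a)
    {x y : List S} (h : x.Sublist y) : MonotoneDomination r x y := by
  obtain ⟨f, hf⟩ := List.sublist_iff_exists_fin_orderEmbedding_get_eq.1 h
  exact ⟨f, f.strictMono, fun i => hf i ▸ hr _⟩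

theorem MonotoneDomination.trans {S : Type} {r : S → S → Prop}
    (hr : ∀ a b c, r a b → r b c → r a c) {x y z : List S}
    (hxy : MonotoneDomination r x y) (hyz : MonotoneDomination r y z) :
    MonotoneDomination r x z := by
  obtain ⟨f, hf, hfr⟩ := hxy
  obtain ⟨g, hg, hgr⟩ := hyz
  exact ⟨g ∘ f, hg.comp hf, fun i => hr _ _ _ (hfr i) (hgr (f i))⟩

theorem PowersetOrder.refl {S : Type} {r : S → S → Prop} (hr : ∀ a, r a a) (A : Set S) :
    PowersetOrder r A A :=
  fun a ha => ⟨a, ha, hr a⟩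

theorem PowersetOrder.trans {S : Type} {r : S → S → Prop}
    (hr : ∀ a b c, r a b → r b c → r a c) {A B C : Set S}
    (hAB : PowersetOrder r A B) (hBC : PowersetOrder r B C) : PowersetOrder r A C := by
  intro a ha
  obtain ⟨b, hb, hab⟩ := hAB a ha
  obtain ⟨c, hc, hbc⟩ := hBC b hb
  exact ⟨c, hc, hr a b c hab hbc⟩

/-- The subwords of the words in a set. -/
def subwords {S : Type} (A : Set (List S)) : Set (List S) := {x | ∃ y ∈ A, x.Sublist y}

/-- Reflexivity of the order on letters suffices, because the subword order already refines monotone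
domination. -/
theorem powersetOrder_of_subwords_subset {S : Type} {r : S → S → Prop} (hr : ∀ a, r a a)
    {A B : Set (List S)} (h : subwords A ⊆ subwords B) :
    PowersetOrder (MonotoneDomination r) A B := by
  intro a ha
  obtain ⟨b, hb, hab⟩ := h ⟨a, ha, List.Sublist.refl a⟩
  exact ⟨b, hb, monotoneDomination_of_sublist hr hab⟩

theorem exists_subwords_eq_sumLang {S : Type} [Finite S] (A : Set (List S)) :
    ∃ Ps, subwords A = sumLang Ps :=
  exists_sumLang_eq fun _ _ hxy ⟨z, hz, hyz⟩ => ⟨z, hz, hxy.trans hyz⟩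

/-! ### Finiteness of `sub(δ)` -/

/-- A set of programs that contains the program and is closed under transitions. -/
def Program.residuals : Program → Set Program
  | .act t => {.act t, .nil}
  | .test φ => {.test φ}
  | .seq δ₁ δ₂ => (fun γ => .seq γ δ₂) '' δ₁.residuals ∪ δ₂.residuals
  | .choice δ₁ δ₂ => {.choice δ₁ δ₂} ∪ (δ₁.residuals ∪ δ₂.residuals)
  | .par δ₁ δ₂ => Set.image2 .par δ₁.residuals δ₂.residuals
  -- Iterations do not pile up: once `γ` is final, the next step starts from `.star δ` and again
  -- yields a single `seq` in front of it.
  | .star δ => {.star δ} ∪ (fun γ => .seq γ (.star δ)) '' δ.residuals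

theorem Program.finite_residuals (δ : Program) : δ.residuals.Finite := by
  induction δ with
  | act t => exact (Set.finite_singleton _).insert _
  | test φ => exact Set.finite_singleton _
  | seq δ₁ δ₂ ih₁ ih₂ => exact (ih₁.image _).union ih₂
  | choice δ₁ δ₂ ih₁ ih₂ => exact (Set.finite_singleton _).union (ih₁.union ih₂)
  | par δ₁ δ₂ ih₁ ih₂ => exact ih₁.image2 _ ih₂
  | star δ ih => exact (Set.finite_singleton _).union (ih.image _)

theorem Program.mem_residuals_self (δ : Program) : δ ∈ δ.residuals := by
  induction δ with
  | act t => exact .inl rfl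
  | test φ => exact rfl
  | seq δ₁ δ₂ ih₁ ih₂ => exact .inl ⟨δ₁, ih₁, rfl⟩
  | choice δ₁ δ₂ ih₁ ih₂ => exact .inl rfl
  | par δ₁ δ₂ ih₁ ih₂ => exact ⟨δ₁, ih₁, δ₂, ih₂, rfl⟩
  | star δ ih => exact .inl rfl

theorem Trans.mem_residuals {w : World} {δ ρ ρ' : Program} {z z' : TimedTrace} {ν ν' : Valuation}
    (hρ : ρ ∈ δ.residuals) (h : Trans w ⟨z, ν, ρ⟩ ⟨z', ν', ρ'⟩) : ρ' ∈ δ.residuals := by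
  induction δ generalizing ρ ρ' with
  | act t =>
    rcases hρ with rfl | rfl
    · cases h
      exact .inr rfl
    · cases h
  | test φ =>
    cases Set.mem_singleton_iff.1 hρ
    cases h
  | seq δ₁ δ₂ ih₁ ih₂ =>
    rcases hρ with ⟨γ, hγ, rfl⟩ | hρ
    · cases h with
      | seq_left h => exact .inl ⟨_, ih₁ hγ h, rfl⟩
      | seq_right _ h => exact .inr (ih₂ δ₂.mem_residuals_self h)
    · exact .inr (ih₂ hρ h)
  | choice δ₁ δ₂ ih₁ ih₂ =>
    rcases hρ with rfl | hρ | hρ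
    · cases h with
      | choice_left h => exact .inr (.inl (ih₁ δ₁.mem_residuals_self h))
      | choice_right h => exact .inr (.inr (ih₂ δ₂.mem_residuals_self h))
    · exact .inr (.inl (ih₁ hρ h))
    · exact .inr (.inr (ih₂ hρ h))
  | par δ₁ δ₂ ih₁ ih₂ =>
    obtain ⟨γ₁, h₁, γ₂, h₂, rfl⟩ := hρ
    cases h with
    | par_left h => exact ⟨_, ih₁ h₁ h, _, h₂, rfl⟩
    | par_right h => exact ⟨_, h₁, _, ih₂ h₂ h, rfl⟩
  | star δ ih =>
    rcases hρ with rfl | ⟨γ, hγ, rfl⟩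
    · cases h with
      | star h => exact .inr ⟨_, ih δ.mem_residuals_self h, rfl⟩
    · cases h with
      | seq_left h => exact .inr ⟨_, ih hγ h, rfl⟩
      | seq_right _ h =>
        cases h with
        | star h => exact .inr ⟨_, ih δ.mem_residuals_self h, rfl⟩

/-- The residuals depend on the program alone, so they bound the reachable programs of all worlds at
once. -/
theorem ActionTheory.finite_sub (𝒟 : ActionTheory) (δ : Program) : (𝒟.sub δ).Finite := by
  refine δ.finite_residuals.subset ?_
  rintro ρ ⟨w, -, z, ν, h⟩
  have main : ∀ c, Relation.ReflTransGen (Trans w) ⟨.nil, 0, δ⟩ c → c.prog ∈ δ.residuals := by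
    intro c hc
    induction hc with
    | refl => exact δ.mem_residuals_self
    | tail _ h ih => exact Trans.mem_residuals ih h
  exact main _ h

/-! ### Finiteness of `P_Σ` and of the alphabet `Λ` -/

theorem finite_setOf_primitive_syms_subset {S : Set Sym} (hS : S.Finite) :
    {f : Primitive | f.syms ⊆ S}.Finite := by
  have hP : {P : Pred | Sym.pred P ∈ S}.Finite :=
    hS.preimage fun _ _ _ _ h => Sym.pred.inj h
  have hN : {n : OAName | n.syms ⊆ S}.Finite := by
    have hobj : {n : ObjName | Sym.obj n ∈ S}.Finite := hS.preimage fun _ _ _ _ h => Sym.obj.inj h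
    have hact : {n : ActName | Sym.act n ∈ S}.Finite := hS.preimage fun _ _ _ _ h => Sym.act.inj h
    refine ((hobj.image OAName.obj).union (hact.image OAName.act)).subset ?_
    rintro (n | n) hn
    · exact .inl ⟨n, hn rfl, rfl⟩
    -- An action name occurs among its own symbols, so its arguments need not be counted.
    · exact .inr ⟨n, hn (.inl rfl), rfl⟩
  have hC : {c : ClkName | Sym.clk c ∈ S}.Finite := hS.preimage fun _ _ _ _ h => Sym.clk.inj h
  refine ((hP.biUnion fun P _ =>
    (Set.Finite.pi' fun _ : Fin P.arity => hN).image (Primitive.rel P)).union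
      (hC.image Primitive.reset)).subset ?_
  rintro (⟨P, ns⟩ | c) hf
  · refine .inl (Set.mem_biUnion (x := P) (hf (.inl rfl)) ⟨ns, fun i => ?_, rfl⟩)
    exact (Set.subset_iUnion (fun i => (ns i).syms) i).trans (Set.subset_union_right.trans hf)
  · exact .inr ⟨c, hf (.inr rfl), rfl⟩

theorem finite_REG (K : ℕ) : (REG K).Finite := by
  refine ((Set.finite_Iic (2 * K + 1)).image (region K)).subset ?_
  rintro r ⟨j, hj, rfl⟩
  exact ⟨j, hj, rfl⟩

theorem finite_regLetter {𝒟 : ActionTheory} (h : 𝒟.clocks.Finite) (φ : MTL 𝒟.primes)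
    (𝒜 : ATA (Set 𝒟.primes)) : Finite (RegLetter 𝒟 φ 𝒜) := by
  have := h.to_subtype
  have := 𝒜.finite_loc
  have := (finite_REG φ.maxConst).to_subtype
  infer_instance

/-! ### The order on the states -/

theorem DTState.wellQuasiOrdered_le {𝒟 : ActionTheory} (hclocks : 𝒟.clocks.Finite)
    (hsyms : 𝒟.syms.Finite) (w : World) (δ : Program) (φ : MTL 𝒟.primes)
    (𝒜 : ATA (Set 𝒟.primes)) :
    WellQuasiOrdered (DTState.Le (δ := δ) (φ := φ) (𝒜 := 𝒜) w) := by
  have : Finite 𝒟.primes := (finite_setOf_primitive_syms_subset hsyms).to_subtype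
  have : Finite (𝒟.sub δ) := (𝒟.finite_sub δ).to_subtype
  have : Finite (RegLetter 𝒟 φ 𝒜) := finite_regLetter hclocks φ 𝒜
  -- Each state is coded by an expression for the subword closure of its third component, together
  -- with two finite data compared by equality.
  choose Ps hPs using fun x : DTState 𝒟 δ φ 𝒜 => exists_subwords_eq_sumLang x.configs
  have hwords := wellQuasiOrdered_sublistForall₂ (wellQuasiOrdered_sublistForall₂
    (Finite.wellQuasiOrdered (α := RegLetter 𝒟 φ 𝒜 ⊕ Set (RegLetter 𝒟 φ 𝒜)) (· = ·)))
  have hprod := (Finite.wellQuasiOrdered (α := Set (Set 𝒟.primes) × 𝒟.sub δ) (· = ·)).prod hwords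
  intro f
  obtain ⟨i, j, hij, heq, hle⟩ := hprod fun n =>
    ((𝒟.fluentsAt w '' 𝒟.tw w δ (f n).trace, (f n).prog), Ps (f n))
  refine ⟨i, j, hij, congrArg Prod.fst heq, congrArg Prod.snd heq,
    powersetOrder_of_subwords_subset (fun a => subset_rfl) ?_⟩
  rw [hPs, hPs]
  exact sumLang_mono hle

theorem DTState.Le.refl {𝒟 : ActionTheory} {δ : Program} {φ : MTL 𝒟.primes}
    {𝒜 : ATA (Set 𝒟.primes)} (w : World) (x : DTState 𝒟 δ φ 𝒜) : x.Le w x :=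
  ⟨rfl, rfl, PowersetOrder.refl
    (fun a => monotoneDomination_of_sublist (fun _ => subset_rfl) (List.Sublist.refl a)) _⟩

theorem DTState.Le.trans {𝒟 : ActionTheory} {δ : Program} {φ : MTL 𝒟.primes}
    {𝒜 : ATA (Set 𝒟.primes)} {w : World} {x y z : DTState 𝒟 δ φ 𝒜} (hxy : x.Le w y)
    (hyz : y.Le w z) : x.Le w z := by
  refine ⟨hxy.1.trans hyz.1, hxy.2.1.trans hyz.2.1, PowersetOrder.trans ?_ hxy.2.2 hyz.2.2⟩
  intro a b c hab hbc
  refine MonotoneDomination.trans ?_ hab hbc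
  exact fun _ _ _ => Set.Subset.trans

end TimedGolog

theorem mainTheorem3 (𝒟 : TimedGolog.ActionTheory) (h𝒟 : 𝒟.IsBAT) (hfd : 𝒟.IsFiniteDomain)
    (hvoc : 𝒟.syms.Finite) (w : TimedGolog.World) (hw : w.Models 𝒟) (δ : TimedGolog.Program)
    (φ : TimedGolog.MTL 𝒟.primes) (𝒜 : TimedGolog.ATA (Set 𝒟.primes)) :
    (∀ x : TimedGolog.DTState 𝒟 δ φ 𝒜, x.Le w x) ∧
    (∀ x y z : TimedGolog.DTState 𝒟 δ φ 𝒜, x.Le w y → y.Le w z → x.Le w z) ∧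
    WellQuasiOrdered (TimedGolog.DTState.Le (δ := δ) (φ := φ) (𝒜 := 𝒜) w) :=
  ⟨TimedGolog.DTState.Le.refl w, fun _ _ _ => TimedGolog.DTState.Le.trans,
    TimedGolog.DTState.wellQuasiOrdered_le h𝒟.finite_clocks hvoc w δ φ 𝒜⟩
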